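/- \textbf{Setting.} A concurrent program $P$ consists of a finite set of processes, a finite set of shared variables ranging over a finite data domain $V$, and, for each process $p$, a finite set of registers, a finite set of labels, an instruction at each label, and a positive scheduling weight $w(p)$. Instructions are: a write $x := e$, a read $a := x$, a local assignment $a := e$, a compare-and-swap $\mathrm{CAS}(x,e_0,e_1)$, a conditional jump, and termination, where $a$ is a register, $x$ a shared variable and $e,e_0,e_1$ are expressions over the registers of the process; each instruction names the labels at which control continues. A configuration $\gamma$ (of the set $\Gamma_P$) assigns to each process its current label, the values of its registers and its buffer, which is a finite first-in first-out word of pending writes $(x,v)$, and to each shared variable its value in memory. It is plain if all buffers are empty; $\Gamma_P^{\mathrm{plain}}$ is the set of plain configurations. \emph{Process transitions.} A process executes its current instruction: a write appends $(x,v)$ to its own buffer; a read takes the most recent pending write on $x$ in its own buffer if there is one and the value of $x$ in memory otherwise; a CAS requires its own buffer to be empty and, if the value of $x$ in memory equals $e_0$, replaces it by $e_1$ (if it differs, the CAS blocks or, if the instruction names a failure label, moves there); assignments and jumps are local. A process is enabled in $\gamma$ if it can make such a step; a terminated process is not enabled. \emph{Updates.} A single update by $p$ removes the oldest write from the buffer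 of $p$ and performs it on the memory (it is impossible if the buffer is empty). A word $w$ of processes labels an update $\gamma\to^w\gamma'$ if performing the single updates by the letters of $w$, in order, is possible and leads from $\gamma$ to $\gamma'$. \emph{The Markov chain.} A step of the PTSO Markov chain of $P$ from $\gamma$ is a process transition followed by an update. If some process is enabled in $\gamma$, then the process that makes its step is chosen with probability $w(p)/\sum_{q \text{ enabled in } \gamma} w(q)$ among the enabled processes $p$; otherwise $\gamma$ is left unchanged. From the resulting configuration $\gamma''$, a word is chosen uniformly at random among the (finitely many) words that label an update from $\gamma''$, and that update is performed. Let $\mu_{P,\gamma}$ denote the probability measure on the infinite runs of this chain that start in $\gamma$. \textbf{Statement.} For every program $P$, the set $\Gamma_P^{\mathrm{plain}}$ is finite and is an attractor: from every configuration $\gamma\in\Gamma_P$ it is eventually reached with probability $1$, and in fact it is visited infinitely often with probability $1$: $$\mu_{P,\gamma}\bigl(\{\rho : \rho_n\in\Gamma_P^{\mathrm{plain}} \text{ for infinitely many } n\}\bigr)=1 .$$ -/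

import Mathlib

open MeasureTheory ProbabilityTheory
open scoped NNReal ENNReal

/-!
Concurrent programs over the PTSO (probabilistic total store order) memory model: syntax,
operational semantics, the induced Markov chain, and the probability measure on its runs.
-/

namespace PTSO

/-- Instructions of a process with register set `R` and label set `L`, over shared variables `Var`
and data domain `Val`. Expressions are arbitrary functions of the local register valuation. Each
instruction names the label(s) at which control continues, so that conditionals, loops and jumps
are all instances of `branch`. -/
inductive Instr (Var Val R L : Type*) where
  /-- `x := e` -/
  | write (x : Var) (e : (R → Val) → Val) (next : L)
  /-- `a := x` -/
  | read (a : R) (x : Var) (next : L)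
  /-- `a := e` -/
  | assign (a : R) (e : (R → Val) → Val) (next : L)
  /-- `CAS(x, e₀, e₁)`. If the value of `x` differs from `e₀`, the instruction blocks when
  `fail = none`, and control moves to `l` when `fail = some l`. -/
  | cas (x : Var) (e₀ e₁ : (R → Val) → Val) (next : L) (fail : Option L)
  /-- `if c then goto tnext else goto fnext` -/
  | branch (c : (R → Val) → Bool) (tnext fnext : L)
  /-- termination: no further step of the process -/
  | term

/-- A program: for each process `p` a set `Reg p` of registers, a set `Label p` of labels, the
instruction found at each label, and a positive scheduling weight. -/
structure Program (Proc Var Val : Type*) (Reg Label : Proc → Type*) where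
  instr : ∀ p, Label p → Instr Var Val (Reg p) (Label p)
  weight : Proc → ℝ≥0
  weight_pos : ∀ p, 0 < weight p

/-- A configuration: the next label of each process, the registers of each process, the store
buffer of each process (oldest pending write first), and the shared memory. -/
@[ext]
structure Conf (Proc Var Val : Type*) (Reg Label : Proc → Type*) where
  label : ∀ p, Label p
  reg : ∀ p, Reg p → Val
  buf : Proc → List (Var × Val)
  mem : Var → Val

section

variable {Proc Var Val : Type*} {Reg Label : Proc → Type*}

namespace Conf

/-- The size of a configuration: the total length of its buffers. -/
def size [Fintype Proc] (γ : Conf Proc Var Val Reg Label) : ℕ := ∑ p, (γ.buf p).length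

/-- A configuration is plain if all its buffers are empty. -/
def Plain (γ : Conf Proc Var Val Reg Label) : Prop := ∀ p, γ.buf p = []

/-- The value process `p` reads from `x`: that of its most recent pending write on `x` if its
buffer holds one, and otherwise the value of `x` in the memory. -/
def readVal [DecidableEq Var] (γ : Conf Proc Var Val Reg Label) (p : Proc) (x : Var) : Val :=
  match (γ.buf p).reverse.find? (fun c => c.1 = x) with
  | some c => c.2
  | none => γ.mem x

variable [DecidableEq Proc]

/-- Move process `p` to label `l`. -/
def goto (γ : Conf Proc Var Val Reg Label) (p : Proc) (l : Label p) :
    Conf Proc Var Val Reg Label :=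
  { γ with label := Function.update γ.label p l }

/-- Give register `a` of process `p` the value `v`. -/
def setReg (γ : Conf Proc Var Val Reg Label) (p : Proc) [DecidableEq (Reg p)] (a : Reg p)
    (v : Val) : Conf Proc Var Val Reg Label :=
  { γ with reg := Function.update γ.reg p (Function.update (γ.reg p) a v) }

variable [DecidableEq Var]

/-- The single update by process `p`: its oldest pending write is moved to the memory. Undefined if
the buffer of `p` is empty. -/
def update₁ (γ : Conf Proc Var Val Reg Label) (p : Proc) : Option (Conf Proc Var Val Reg Label) :=
  match γ.buf p with
  | [] => none
  | (x, v) :: b =>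
      some { γ with buf := Function.update γ.buf p b, mem := Function.update γ.mem x v }

/-- The update labelled by a word of processes: one single update for each letter, in order. -/
def update (γ : Conf Proc Var Val Reg Label) : List Proc → Option (Conf Proc Var Val Reg Label)
  | [] => some γ
  | p :: w => (γ.update₁ p).bind fun γ' => γ'.update w

/-- The words that label an update from `γ`. -/
def updateWords (γ : Conf Proc Var Val Reg Label) : Set (List Proc) :=
  {w | (γ.update w).isSome}

theorem size_of_update₁ [Fintype Proc] {γ γ' : Conf Proc Var Val Reg Label} {p : Proc}
    (h : γ.update₁ p = some γ') : γ'.size + 1 = γ.size := by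
  unfold update₁ at h
  split at h
  · simp at h
  · rename_i x v b hb
    obtain rfl := Option.some.inj h
    unfold size
    rw [← Finset.add_sum_erase _ _ (Finset.mem_univ p),
      ← Finset.add_sum_erase (a := p) (f := fun q => (γ.buf q).length) _ (Finset.mem_univ p)]
    have : ∑ q ∈ Finset.univ.erase p, (Function.update γ.buf p b q).length =
        ∑ q ∈ Finset.univ.erase p, (γ.buf q).length :=
      Finset.sum_congr rfl fun q hq => by
        rw [Function.update_of_ne (Finset.ne_of_mem_erase hq)]
    rw [this, hb]
    simp
    omega

theorem length_le_size [Fintype Proc] (w : List Proc) :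
    ∀ γ : Conf Proc Var Val Reg Label, w ∈ γ.updateWords → w.length ≤ γ.size := by
  induction w with
  | nil => simp
  | cons p w ih =>
    intro γ h
    simp only [updateWords, Set.mem_ofPred_eq, update] at h
    cases h' : γ.update₁ p with
    | none => simp [h'] at h
    | some γ' =>
      have h1 := ih γ' (by simpa [h', updateWords] using h)
      have h2 := size_of_update₁ h'
      simp only [List.length_cons]
      omega

theorem finite_updateWords [Fintype Proc] (γ : Conf Proc Var Val Reg Label) :
    γ.updateWords.Finite :=
  (List.finite_length_le Proc γ.size).subset fun w hw => length_le_size w γ hw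

theorem nonempty_updateWords [Fintype Proc] (γ : Conf Proc Var Val Reg Label) :
    γ.finite_updateWords.toFinset.Nonempty :=
  ⟨[], by simp [updateWords, update]⟩

/-- The distribution of the outcome of an update from `γ`: a word is chosen uniformly among all
words that label an update from `γ`, so `γ'` has probability
`|{w | γ.update w = some γ'}| / |γ.updateWords|`. -/
noncomputable def updateDist [Fintype Proc] (γ : Conf Proc Var Val Reg Label) :
    PMF (Conf Proc Var Val Reg Label) :=
  (PMF.uniformOfFinset γ.finite_updateWords.toFinset γ.nonempty_updateWords).map
    fun w => (γ.update w).getD γ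

end Conf

/-- Every set of configurations is measurable. -/
instance : MeasurableSpace (Conf Proc Var Val Reg Label) := ⊤

namespace Program

variable [DecidableEq Proc] [DecidableEq Var] [DecidableEq Val] [∀ p, DecidableEq (Reg p)]

/-- The process transition of `p` from `γ`: the configuration after `p` executes its next
instruction, or `none` if `p` is not enabled in `γ`. -/
def procStep (P : Program Proc Var Val Reg Label) (γ : Conf Proc Var Val Reg Label) (p : Proc) :
    Option (Conf Proc Var Val Reg Label) :=
  match P.instr p (γ.label p) with
  | .write x e next =>
      some ({ γ with
        buf := Function.update γ.buf p (γ.buf p ++ [(x, e (γ.reg p))]) }.goto p next)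
  | .read a x next => some ((γ.setReg p a (γ.readVal p x)).goto p next)
  | .assign a e next => some ((γ.setReg p a (e (γ.reg p))).goto p next)
  | .cas x e₀ e₁ next fail =>
      if γ.buf p = [] then
        if γ.mem x = e₀ (γ.reg p) then
          some ({ γ with mem := Function.update γ.mem x (e₁ (γ.reg p)) }.goto p next)
        else fail.map fun l => γ.goto p l
      else none
  | .branch c tnext fnext => some (γ.goto p (if c (γ.reg p) then tnext else fnext))
  | .term => none

variable [Fintype Proc]

/-- The processes enabled in `γ`. -/
def enabled (P : Program Proc Var Val Reg Label) (γ : Conf Proc Var Val Reg Label) :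
    Finset Proc :=
  {p | (P.procStep γ p).isSome}

/-- The relative weight of `p` in `γ`: its share of the total weight of the enabled processes. -/
noncomputable def relWeight (P : Program Proc Var Val Reg Label)
    (γ : Conf Proc Var Val Reg Label) (p : Proc) : ℝ≥0 :=
  if p ∈ P.enabled γ then P.weight p / ∑ q ∈ P.enabled γ, P.weight q else 0

theorem sum_relWeight (P : Program Proc Var Val Reg Label) {γ : Conf Proc Var Val Reg Label}
    (h : (P.enabled γ).Nonempty) : ∑ p, (P.relWeight γ p : ℝ≥0∞) = 1 := by
  have h0 : ∑ q ∈ P.enabled γ, P.weight q ≠ 0 :=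
    (Finset.sum_pos (fun q _ => P.weight_pos q) h).ne'
  rw [← ENNReal.ofNNReal_finsetSum, ENNReal.coe_eq_one]
  simp only [relWeight]
  rw [← Finset.sum_filter, Finset.filter_mem_eq_inter, Finset.univ_inter, ← Finset.sum_div,
    div_self h0]

/-- The scheduler's choice of a process in a configuration with an enabled process. -/
noncomputable def schedule (P : Program Proc Var Val Reg Label)
    (γ : Conf Proc Var Val Reg Label) (h : (P.enabled γ).Nonempty) : PMF Proc :=
  PMF.ofFintype (fun p => (P.relWeight γ p : ℝ≥0∞)) (P.sum_relWeight h)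

/-- The distribution of the outcome of the process transition from `γ`: an enabled process, chosen
according to the relative weights, performs its step; if there is none, `γ` is unchanged. -/
noncomputable def procDist (P : Program Proc Var Val Reg Label)
    (γ : Conf Proc Var Val Reg Label) : PMF (Conf Proc Var Val Reg Label) :=
  if h : (P.enabled γ).Nonempty then
    (P.schedule γ h).map fun p => (P.procStep γ p).getD γ
  else PMF.pure γ

/-- The transition probabilities of the Markov chain of `P`: a process transition followed by an
update, that is,
`P.trans γ γ' = ∑' γ'', P.procDist γ γ'' * γ''.updateDist γ'`. -/
noncomputable def trans (P : Program Proc Var Val Reg Label)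
    (γ : Conf Proc Var Val Reg Label) : PMF (Conf Proc Var Val Reg Label) :=
  (P.procDist γ).bind fun γ' => γ'.updateDist

/-- The transition probabilities as a Markov kernel. -/
noncomputable def kernel (P : Program Proc Var Val Reg Label) :
    Kernel (Conf Proc Var Val Reg Label) (Conf Proc Var Val Reg Label) where
  toFun γ := (P.trans γ).toMeasure
  measurable' := measurable_from_top

instance (P : Program Proc Var Val Reg Label) : IsMarkovKernel P.kernel :=
  ⟨fun γ => inferInstanceAs (IsProbabilityMeasure (P.trans γ).toMeasure)⟩

/-- The probability measure, on infinite sequences of configurations, of the runs of the Markov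
chain of `P` that start in `γ`. -/
noncomputable def runMeasure (P : Program Proc Var Val Reg Label)
    (γ : Conf Proc Var Val Reg Label) : Measure (ℕ → Conf Proc Var Val Reg Label) :=
  Kernel.traj (X := fun _ => Conf Proc Var Val Reg Label)
    (fun n => P.kernel.comap (fun x => x ⟨n, Finset.mem_Iic.2 le_rfl⟩) (measurable_pi_apply _))
    0 (fun _ => γ)

instance (P : Program Proc Var Val Reg Label) (γ : Conf Proc Var Val Reg Label) :
    IsProbabilityMeasure (P.runMeasure γ) :=
  inferInstanceAs (IsProbabilityMeasure (Kernel.traj _ 0 _))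

/-- `S` is an attractor: from every configuration, `S` is eventually reached with
probability one. -/
def IsAttractor (P : Program Proc Var Val Reg Label) (S : Set (Conf Proc Var Val Reg Label)) :
    Prop :=
  ∀ γ, P.runMeasure γ {ρ | ∃ n, ρ n ∈ S} = 1

end Program

end

end PTSO

/-! ### Expectations under discrete distributions. -/

section PMFLemmas

variable {α β : Type*}

/-! A uniformly random update tends to drain the buffers. Any update word shorter than the size
extends by a letter, so longer words are at least as numerous as shorter ones (`wordCount_mono`).
Chebyshev's sum inequality then bounds the mean of any monotone function of the remaining size by
its mean over `0, …, size` (`sum_updateWords_le`).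

Take the potential that is `0` on plain configurations and `size + 2` elsewhere. A process
transition adds at most one pending write, so one step of the chain has expected potential at most
`4/5 * (size + 2)`, from every configuration, plain or not (`lintegral_kernel_potential_le`). Since
the potential is `size + 2` times the indicator of not being plain, iterating with the Markov
property bounds the probability of avoiding plain configurations at times `n + 1, …, n + k` by
`(4/5)^k` times the expectation of `size + 2` at time `n`, which is finite. Letting `k → ∞` and then
taking a countable union over `n` gives infinitely many visits almost surely. -/

theorem PMF.tsum_map_mul (p : PMF α) (f : α → β) (g : β → ℝ≥0∞) :
    ∑' y, p.map f y * g y = ∑' x, p x * g (f x) := by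
  classical
  simp_rw [PMF.map_apply, ← ENNReal.tsum_mul_right]
  rw [ENNReal.tsum_comm]
  refine tsum_congr fun x => ?_
  rw [tsum_eq_single (f x) (by intro y hy; simp [hy])]
  simp

theorem PMF.tsum_bind_mul (p : PMF α) (f : α → PMF β) (g : β → ℝ≥0∞) :
    ∑' y, p.bind f y * g y = ∑' x, p x * ∑' y, f x y * g y := by
  simp_rw [PMF.bind_apply, ← ENNReal.tsum_mul_right]
  rw [ENNReal.tsum_comm]
  simp_rw [← ENNReal.tsum_mul_left, mul_assoc]

theorem PMF.tsum_mul_le (p : PMF α) {g : α → ℝ≥0∞} {c : ℝ≥0∞} (h : ∀ x, g x ≤ c) :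
    ∑' x, p x * g x ≤ c :=
  calc ∑' x, p x * g x ≤ ∑' x, p x * c := ENNReal.tsum_le_tsum fun x => by gcongr; exact h x
    _ = c := by rw [ENNReal.tsum_mul_right, p.tsum_coe, one_mul]

theorem PMF.lintegral_toMeasure [MeasurableSpace α] (p : PMF α) {g : α → ℝ≥0∞}
    (hg : Measurable g) : ∫⁻ x, g x ∂p.toMeasure = ∑' x, p x * g x := by
  have h : p.toMeasure = Measure.sum fun x => p x • Measure.dirac x := by
    ext s hs
    rw [PMF.toMeasure_apply _ hs, Measure.sum_apply _ hs]
    refine tsum_congr fun x => ?_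
    by_cases hx : x ∈ s <;> simp [hx, hs]
  rw [h, lintegral_sum_measure]
  refine tsum_congr fun x => ?_
  rw [lintegral_smul_measure, lintegral_dirac' _ hg, smul_eq_mul]

end PMFLemmas

namespace PTSO

variable {Proc Var Val : Type*} {Reg Label : Proc → Type*}

/-! ### Buffer sizes under updates. -/

namespace Conf

theorem plain_iff_size [Fintype Proc] (γ : Conf Proc Var Val Reg Label) :
    γ.Plain ↔ γ.size = 0 := by
  simp [Plain, size]

theorem finite_plain [Finite Proc] [Finite Var] [Finite Val] [∀ p, Finite (Reg p)]
    [∀ p, Finite (Label p)] : {γ : Conf Proc Var Val Reg Label | γ.Plain}.Finite := by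
  refine Set.Finite.of_injOn (f := fun γ => (γ.label, γ.reg, γ.mem)) (t := Set.univ)
    (fun _ _ => Set.mem_univ _) ?_ Set.finite_univ
  intro γ hγ γ' hγ' h
  simp only [Prod.mk.injEq] at h
  exact Conf.ext h.1 h.2.1 (funext fun p => (hγ p).trans (hγ' p).symm) h.2.2

variable [DecidableEq Proc] [DecidableEq Var]

theorem update_append (w w' : List Proc) : ∀ γ : Conf Proc Var Val Reg Label,
    γ.update (w ++ w') = (γ.update w).bind fun γ' => γ'.update w' := by
  induction w with
  | nil => intro γ; rfl
  | cons p w ih =>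
    intro γ
    simp only [List.cons_append, update, Option.bind_assoc, ih]

variable [Fintype Proc]

theorem size_of_update (w : List Proc) : ∀ {γ γ' : Conf Proc Var Val Reg Label},
    γ.update w = some γ' → γ'.size + w.length = γ.size := by
  induction w with
  | nil => intro γ γ' h; simp [update] at h; simp [h]
  | cons p w ih =>
    intro γ γ' h
    obtain ⟨γ₁, h₁, h₂⟩ := Option.bind_eq_some_iff.1 h
    have := ih h₂
    have := size_of_update₁ h₁
    simp only [List.length_cons]
    omega

theorem exists_update₁ {γ : Conf Proc Var Val Reg Label} (h : 0 < γ.size) :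
    ∃ p, (γ.update₁ p).isSome := by
  have : ¬ γ.Plain := by rw [plain_iff_size]; omega
  simp only [Plain, not_forall] at this
  obtain ⟨p, hp⟩ := this
  refine ⟨p, ?_⟩
  unfold update₁
  split
  · contradiction
  · rfl

/-! ### Counting update words by length. -/

/-- The number of words of length `k` that label an update. -/
noncomputable def wordCount (γ : Conf Proc Var Val Reg Label) (k : ℕ) : ℕ :=
  (γ.finite_updateWords.toFinset.filter fun w => w.length = k).card

/-- A word of length below the size leaves some buffer nonempty, hence extends by a letter; so
dropping the last letter maps onto the words of length `k`. -/
theorem wordCount_le_succ (γ : Conf Proc Var Val Reg Label) {k : ℕ} (hk : k < γ.size) :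
    γ.wordCount k ≤ γ.wordCount (k + 1) := by
  refine Finset.card_le_card_of_surjOn List.dropLast fun w hw => ?_
  simp only [Finset.coe_filter, Set.Finite.mem_toFinset, Set.mem_ofPred_eq, updateWords,
    Set.mem_image] at hw ⊢
  obtain ⟨hw, hl⟩ := hw
  obtain ⟨γ', h'⟩ := Option.isSome_iff_exists.1 hw
  have hs := size_of_update w h'
  obtain ⟨p, hp⟩ := exists_update₁ (γ := γ') (by omega)
  obtain ⟨γ'', hp⟩ := Option.isSome_iff_exists.1 hp
  exact ⟨w ++ [p], ⟨by simp [update_append, h', update, hp], by simp [hl]⟩, by simp⟩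

theorem wordCount_mono (γ : Conf Proc Var Val Reg Label) {k l : ℕ} (hkl : k ≤ l)
    (hl : l ≤ γ.size) : γ.wordCount k ≤ γ.wordCount l := by
  induction l, hkl using Nat.le_induction with
  | base => exact le_rfl
  | succ l _ ih => exact (ih (by omega)).trans (γ.wordCount_le_succ (by omega))

/-- Chebyshev's inequality for the size after an update: on average, a monotone function of it is
at most its mean over `0, …, γ.size`. -/
theorem sum_updateWords_le (γ : Conf Proc Var Val Reg Label) {φ : ℕ → ℕ} (hφ : Monotone φ) :
    (γ.size + 1) * ∑ w ∈ γ.finite_updateWords.toFinset, φ (γ.size - w.length) ≤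
      γ.finite_updateWords.toFinset.card * ∑ j ∈ Finset.range (γ.size + 1), φ j := by
  have hmaps : ∀ w ∈ γ.finite_updateWords.toFinset,
      w.length ∈ Finset.range (γ.size + 1) := fun w hw => by
    have := length_le_size w γ (by simpa using hw)
    simp; omega
  have h₁ : ∑ w ∈ γ.finite_updateWords.toFinset, φ (γ.size - w.length) =
      ∑ k ∈ Finset.range (γ.size + 1), γ.wordCount k * φ (γ.size - k) := by
    rw [← Finset.sum_fiberwise_of_maps_to hmaps]
    refine Finset.sum_congr rfl fun k _ => ?_
    rw [wordCount, ← smul_eq_mul, ← Finset.sum_const]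
    exact Finset.sum_congr rfl fun w hw => by rw [(Finset.mem_filter.1 hw).2]
  have h₂ : γ.finite_updateWords.toFinset.card =
      ∑ k ∈ Finset.range (γ.size + 1), γ.wordCount k :=
    Finset.card_eq_sum_card_fiberwise hmaps
  have h₃ : ∑ j ∈ Finset.range (γ.size + 1), φ j =
      ∑ k ∈ Finset.range (γ.size + 1), φ (γ.size - k) := by
    rw [← Finset.sum_range_reflect]; rfl
  -- As `k` grows, there are more words but `φ` of the remaining size falls: the hypothesis of
  -- Chebyshev's inequality.
  have h₄ : AntivaryOn γ.wordCount (fun k => φ (γ.size - k))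
      (Finset.range (γ.size + 1) : Set ℕ) := by
    intro k hk l hl h
    simp only [Finset.coe_range, Set.mem_Iio] at hk hl
    refine γ.wordCount_mono ?_ (by omega)
    by_contra! hlt
    exact (hφ (show γ.size - l ≤ γ.size - k by omega)).not_gt h
  rw [h₁, h₂, h₃]
  simpa using h₄.card_mul_sum_le_sum_mul_sum

/-! ### Contraction of the potential under an update. -/

/-- The potential of a configuration as a function of its size; it vanishes at plain
configurations. -/
def potential (n : ℕ) : ℕ := if n = 0 then 0 else n + 2

theorem potential_mono : Monotone potential := by
  intro m n h
  unfold potential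
  split_ifs <;> omega

theorem potential_le (n : ℕ) : potential n ≤ n + 2 := by
  unfold potential
  split_ifs <;> omega

theorem sum_range_potential (n : ℕ) :
    2 * ∑ j ∈ Finset.range (n + 1), potential j = n * (n + 1) + 4 * n := by
  induction n with
  | zero => simp [potential]
  | succ n ih =>
    rw [Finset.sum_range_succ, mul_add, ih, potential, if_neg (by omega)]
    ring

/-- The mean of `potential` over `0, …, n` is `n(n+5) / (2(n+1))`. The bound is by `n + 1` because
the preceding process transition may have raised the size by one. The offset `2` in `potential`
matters: with offset `1` the corresponding ratio would be `1` at `n = 1`. -/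
theorem sum_updateWords_potential_le (γ : Conf Proc Var Val Reg Label) :
    5 * ∑ w ∈ γ.finite_updateWords.toFinset, potential (γ.size - w.length) ≤
      4 * (γ.finite_updateWords.toFinset.card * (γ.size + 1)) := by
  have h := γ.sum_updateWords_le potential_mono
  have hs := sum_range_potential γ.size
  generalize ∑ w ∈ γ.finite_updateWords.toFinset, potential (γ.size - w.length) = S at *
  generalize ∑ j ∈ Finset.range (γ.size + 1), potential j = T at *
  generalize γ.finite_updateWords.toFinset.card = c at *
  generalize γ.size = n at *
  have h5 : 5 * T ≤ 4 * (n + 1) * (n + 1) := by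
    zify at hs ⊢
    -- The claim amounts to `3n² - 9n + 8 ≥ 0`, and the left side is `(3(2n - 3)² + 5) / 4`.
    nlinarith [sq_nonneg (2 * (n : ℤ) - 3)]
  refine le_of_mul_le_mul_left ?_ (Nat.succ_pos n)
  calc (n + 1) * (5 * S) = 5 * ((n + 1) * S) := by ring
    _ ≤ 5 * (c * T) := by gcongr
    _ = c * (5 * T) := by ring
    _ ≤ c * (4 * (n + 1) * (n + 1)) := by gcongr
    _ = (n + 1) * (4 * (c * (n + 1))) := by ring

theorem size_getD_update {γ : Conf Proc Var Val Reg Label} {w : List Proc}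
    (hw : w ∈ γ.updateWords) : ((γ.update w).getD γ).size = γ.size - w.length := by
  obtain ⟨γ', h'⟩ := Option.isSome_iff_exists.1 hw
  have := size_of_update w h'
  simp only [h', Option.getD_some]
  omega

theorem tsum_updateDist_mul (γ : Conf Proc Var Val Reg Label) (φ : ℕ → ℕ) :
    ∑' γ', γ.updateDist γ' * (φ γ'.size : ℝ≥0∞) =
      (γ.finite_updateWords.toFinset.card : ℝ≥0∞)⁻¹ *
        ((∑ w ∈ γ.finite_updateWords.toFinset, φ (γ.size - w.length) : ℕ) : ℝ≥0∞) := by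
  rw [updateDist, PMF.tsum_map_mul, tsum_eq_sum (s := γ.finite_updateWords.toFinset)]
  · rw [Nat.cast_sum, Finset.mul_sum]
    refine Finset.sum_congr rfl fun w hw => ?_
    rw [PMF.uniformOfFinset_apply_of_mem _ hw, size_getD_update (by simpa using hw)]
  · intro w hw
    rw [PMF.uniformOfFinset_apply_of_notMem _ hw, zero_mul]

theorem tsum_updateDist_potential_le (γ : Conf Proc Var Val Reg Label) :
    ∑' γ', γ.updateDist γ' * (potential γ'.size : ℝ≥0∞) ≤ 4 / 5 * ((γ.size + 1 : ℕ) : ℝ≥0∞) := by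
  rw [tsum_updateDist_mul]
  have h := γ.sum_updateWords_potential_le
  have hc : γ.finite_updateWords.toFinset.card ≠ 0 :=
    (Finset.card_pos.2 γ.nonempty_updateWords).ne'
  generalize ∑ w ∈ γ.finite_updateWords.toFinset, potential (γ.size - w.length) = S at *
  generalize γ.finite_updateWords.toFinset.card = c at *
  generalize γ.size + 1 = n at *
  have h' : (5 : ℝ≥0∞) * S ≤ 4 * (c * n) := by exact_mod_cast h
  rw [mul_comm, ← div_eq_mul_inv, ENNReal.div_le_iff (by simpa using hc) (by simp)]
  have h5 : (S : ℝ≥0∞) ≤ 4 * (c * n) / 5 := by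
    rw [ENNReal.le_div_iff_mul_le (by simp) (by simp), mul_comm]; exact h'
  refine h5.trans (le_of_eq ?_)
  simp only [div_eq_mul_inv]
  ring

theorem tsum_updateDist_size_le (γ : Conf Proc Var Val Reg Label) :
    ∑' γ', γ.updateDist γ' * ((γ'.size + 2 : ℕ) : ℝ≥0∞) ≤ ((γ.size + 2 : ℕ) : ℝ≥0∞) := by
  rw [updateDist, PMF.tsum_map_mul]
  calc _ ≤ ∑' w, PMF.uniformOfFinset γ.finite_updateWords.toFinset γ.nonempty_updateWords w *
        ((γ.size + 2 : ℕ) : ℝ≥0∞) := ?_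
    _ ≤ _ := PMF.tsum_mul_le _ fun _ => le_rfl
  refine ENNReal.tsum_le_tsum fun w => ?_
  by_cases hw : w ∈ γ.finite_updateWords.toFinset
  · rw [size_getD_update (by simpa using hw)]
    gcongr
    omega
  · rw [PMF.uniformOfFinset_apply_of_notMem _ hw, zero_mul, zero_mul]

end Conf

/-! ### One-step drift of the chain. -/

namespace Program

variable [DecidableEq Proc] [DecidableEq Var] [DecidableEq Val] [∀ p, DecidableEq (Reg p)]
  [Fintype Proc]

theorem size_procStep_le (P : Program Proc Var Val Reg Label)
    {γ γ' : Conf Proc Var Val Reg Label} {p : Proc} (h : P.procStep γ p = some γ') :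
    γ'.size ≤ γ.size + 1 := by
  unfold procStep at h
  split at h
  · rename_i x e next _
    obtain rfl := Option.some.inj h
    simp only [Conf.size, Conf.goto]
    rw [← Finset.add_sum_erase _ _ (Finset.mem_univ p),
      ← Finset.add_sum_erase (a := p) (f := fun q => (γ.buf q).length) _ (Finset.mem_univ p)]
    have : ∑ q ∈ Finset.univ.erase p,
        (Function.update γ.buf p (γ.buf p ++ [(x, e (γ.reg p))]) q).length =
        ∑ q ∈ Finset.univ.erase p, (γ.buf q).length :=
      Finset.sum_congr rfl fun q hq => by
        rw [Function.update_of_ne (Finset.ne_of_mem_erase hq)]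
    rw [this]
    simp
    omega
  · obtain rfl := Option.some.inj h
    exact Nat.le_succ _
  · obtain rfl := Option.some.inj h
    exact Nat.le_succ _
  · rename_i fail _
    split_ifs at h
    · obtain rfl := Option.some.inj h
      exact Nat.le_succ _
    · obtain ⟨l, _, rfl⟩ := Option.map_eq_some_iff.1 h
      exact Nat.le_succ _
  · obtain rfl := Option.some.inj h
    exact Nat.le_succ _
  · simp at h

theorem tsum_procDist_mul_le (P : Program Proc Var Val Reg Label)
    (γ : Conf Proc Var Val Reg Label) {g : Conf Proc Var Val Reg Label → ℝ≥0∞} {c : ℝ≥0∞}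
    (h : ∀ γ' : Conf Proc Var Val Reg Label, γ'.size ≤ γ.size + 1 → g γ' ≤ c) :
    ∑' γ', P.procDist γ γ' * g γ' ≤ c := by
  unfold procDist
  split_ifs with he
  · rw [PMF.tsum_map_mul]
    refine PMF.tsum_mul_le _ fun p => h _ ?_
    cases hp : P.procStep γ p with
    | none => exact Nat.le_succ _
    | some γ' => exact P.size_procStep_le hp
  · rw [tsum_eq_single γ (by intro γ' hγ'; simp [PMF.pure_apply, hγ'])]
    simpa using h γ (Nat.le_succ _)

theorem lintegral_kernel (P : Program Proc Var Val Reg Label)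
    (γ : Conf Proc Var Val Reg Label) (g : Conf Proc Var Val Reg Label → ℝ≥0∞) :
    ∫⁻ γ', g γ' ∂P.kernel γ = ∑' γ', P.procDist γ γ' * ∑' γ'', γ'.updateDist γ'' * g γ'' := by
  rw [show P.kernel γ = (P.trans γ).toMeasure from rfl,
    PMF.lintegral_toMeasure _ measurable_from_top, trans, PMF.tsum_bind_mul]

theorem lintegral_kernel_potential_le (P : Program Proc Var Val Reg Label)
    (γ : Conf Proc Var Val Reg Label) :
    ∫⁻ γ', (Conf.potential γ'.size : ℝ≥0∞) ∂P.kernel γ ≤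
      4 / 5 * ((γ.size + 2 : ℕ) : ℝ≥0∞) := by
  rw [lintegral_kernel]
  refine P.tsum_procDist_mul_le γ fun γ' h => γ'.tsum_updateDist_potential_le.trans
    (mul_le_mul' le_rfl (Nat.cast_le.2 (by omega)))

/-- A crude growth bound, from `size + 3 ≤ 2 * (size + 2)`; it serves only to keep the expected size
finite at each fixed time. -/
theorem lintegral_kernel_size_le (P : Program Proc Var Val Reg Label)
    (γ : Conf Proc Var Val Reg Label) :
    ∫⁻ γ', ((γ'.size + 2 : ℕ) : ℝ≥0∞) ∂P.kernel γ ≤ 2 * ((γ.size + 2 : ℕ) : ℝ≥0∞) := by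
  rw [lintegral_kernel]
  refine P.tsum_procDist_mul_le γ fun γ' h => γ'.tsum_updateDist_size_le.trans ?_
  norm_cast
  omega

/-! ### Geometric decay along runs and recurrence. -/

/-- The Markov property of the run measure. -/
theorem lintegral_runMeasure_succ (P : Program Proc Var Val Reg Label)
    (γ : Conf Proc Var Val Reg Label) (n : ℕ)
    {G : (Finset.Iic n → Conf Proc Var Val Reg Label) → ℝ≥0∞} (hG : Measurable G)
    (h : Conf Proc Var Val Reg Label → ℝ≥0∞) :
    ∫⁻ ρ, G (fun i => ρ i) * h (ρ (n + 1)) ∂P.runMeasure γ =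
      ∫⁻ ρ, G (fun i => ρ i) * ∫⁻ γ', h γ' ∂P.kernel (ρ n) ∂P.runMeasure γ := by
  have hh : Measurable h := measurable_from_top
  let κ : (n : ℕ) → Kernel (Finset.Iic n → Conf Proc Var Val Reg Label)
      (Conf Proc Var Val Reg Label) :=
    fun n => P.kernel.comap (fun x => x ⟨n, Finset.mem_Iic.2 le_rfl⟩) (measurable_pi_apply _)
  -- The joint law of the history up to `n` and the next configuration is the law of the history
  -- composed with the kernel.
  have key := Kernel.partialTraj_compProd_eq_map_traj
    (X := fun _ => Conf Proc Var Val Reg Label) (κ := κ) (Nat.zero_le n) (x₀ := fun _ => γ)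
  have hmeas : Measurable fun z : (Finset.Iic n → Conf Proc Var Val Reg Label) ×
      Conf Proc Var Val Reg Label => G z.1 * h z.2 := by fun_prop
  have h₁ := congrArg (fun μ => ∫⁻ z, G z.1 * h z.2 ∂μ) key
  beta_reduce at h₁
  rw [lintegral_map hmeas (by fun_prop), Measure.lintegral_compProd hmeas,
    ← Kernel.traj_map_frestrictLe_apply, lintegral_map hmeas.lintegral_kernel_prod_right'
      (by fun_prop)] at h₁
  exact h₁.symm.trans (lintegral_congr fun ρ =>
    lintegral_const_mul (G fun i => ρ i) hh)

theorem lintegral_runMeasure_zero (P : Program Proc Var Val Reg Label)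
    (γ : Conf Proc Var Val Reg Label) (h : Conf Proc Var Val Reg Label → ℝ≥0∞) :
    ∫⁻ ρ, h (ρ 0) ∂P.runMeasure γ = h γ := by
  have hh : Measurable h := measurable_from_top
  unfold runMeasure
  rw [Kernel.lintegral_traj _ (by fun_prop)]
  simp [Function.updateFinset]

theorem lintegral_size_le (P : Program Proc Var Val Reg Label)
    (γ : Conf Proc Var Val Reg Label) (n : ℕ) :
    ∫⁻ ρ, (((ρ n).size + 2 : ℕ) : ℝ≥0∞) ∂P.runMeasure γ ≤ 2 ^ n * ((γ.size + 2 : ℕ) : ℝ≥0∞) := by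
  induction n with
  | zero =>
    rw [P.lintegral_runMeasure_zero γ fun γ' => ((γ'.size + 2 : ℕ) : ℝ≥0∞), pow_zero, one_mul]
  | succ n ih =>
    have h := P.lintegral_runMeasure_succ γ n (G := fun _ => 1) measurable_const
      fun γ' => ((γ'.size + 2 : ℕ) : ℝ≥0∞)
    simp only [one_mul] at h
    rw [h]
    have hm : Measurable fun γ : Conf Proc Var Val Reg Label => ((γ.size + 2 : ℕ) : ℝ≥0∞) :=
      measurable_from_top
    calc _ ≤ ∫⁻ ρ, 2 * (((ρ n).size + 2 : ℕ) : ℝ≥0∞) ∂P.runMeasure γ :=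
          lintegral_mono fun ρ => P.lintegral_kernel_size_le (ρ n)
      _ = 2 * ∫⁻ ρ, (((ρ n).size + 2 : ℕ) : ℝ≥0∞) ∂P.runMeasure γ :=
          lintegral_const_mul _ (hm.comp (measurable_pi_apply n))
      _ ≤ 2 * (2 ^ n * ((γ.size + 2 : ℕ) : ℝ≥0∞)) := by gcongr
      _ = _ := by ring

/-- The indicator of not being plain. -/
noncomputable def notPlain (γ : Conf Proc Var Val Reg Label) : ℝ≥0∞ := if γ.size = 0 then 0 else 1

/-- The runs that are not plain at the times `n + 1, …, n + k` contribute geometrically little to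
the expected size at time `n + k`. -/
theorem lintegral_prod_notPlain_le (P : Program Proc Var Val Reg Label)
    (γ : Conf Proc Var Val Reg Label) (n k : ℕ) :
    ∫⁻ ρ, (∏ j ∈ Finset.range k, notPlain (ρ (n + 1 + j))) * (((ρ (n + k)).size + 2 : ℕ) : ℝ≥0∞)
      ∂P.runMeasure γ ≤ (4 / 5) ^ k * (2 ^ n * ((γ.size + 2 : ℕ) : ℝ≥0∞)) := by
  induction k with
  | zero => simpa using P.lintegral_size_le γ n
  | succ k ih =>
    have hnp : Measurable fun γ : Conf Proc Var Val Reg Label => notPlain γ :=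
      measurable_from_top
    have hm : Measurable fun γ : Conf Proc Var Val Reg Label => ((γ.size + 2 : ℕ) : ℝ≥0∞) :=
      measurable_from_top
    let G : (Finset.Iic (n + k) → Conf Proc Var Val Reg Label) → ℝ≥0∞ := fun x =>
      ∏ j : Fin k, notPlain (x ⟨n + 1 + j, Finset.mem_Iic.2 (by omega)⟩)
    have hG : Measurable G :=
      Finset.measurable_prod _ fun j _ => hnp.comp (measurable_pi_apply _)
    have hGe : ∀ ρ : ℕ → Conf Proc Var Val Reg Label,
        G (fun i => ρ i) = ∏ j ∈ Finset.range k, notPlain (ρ (n + 1 + j)) := fun ρ =>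
      Fin.prod_univ_eq_prod_range (fun j => notPlain (ρ (n + 1 + j))) k
    -- The newest indicator is absorbed into the potential, leaving in `G` only factors that depend
    -- on the history up to `n + k`.
    have hstep : ∀ γ : Conf Proc Var Val Reg Label,
        notPlain γ * ((γ.size + 2 : ℕ) : ℝ≥0∞) = (Conf.potential γ.size : ℝ≥0∞) := fun γ => by
      unfold notPlain Conf.potential
      split_ifs <;> simp
    have hmul : ∀ ρ : ℕ → Conf Proc Var Val Reg Label,
        (∏ j ∈ Finset.range (k + 1), notPlain (ρ (n + 1 + j))) *
          (((ρ (n + (k + 1))).size + 2 : ℕ) : ℝ≥0∞) =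
        G (fun i => ρ i) * (Conf.potential (ρ (n + k + 1)).size : ℝ≥0∞) := fun ρ => by
      rw [hGe, Finset.prod_range_succ, mul_assoc, ← hstep,
        show n + 1 + k = n + k + 1 by ring, ← add_assoc n k 1]
    simp_rw [hmul]
    rw [P.lintegral_runMeasure_succ γ (n + k) hG fun γ => (Conf.potential γ.size : ℝ≥0∞)]
    calc _ ≤ ∫⁻ ρ, 4 / 5 * ((∏ j ∈ Finset.range k, notPlain (ρ (n + 1 + j))) *
            (((ρ (n + k)).size + 2 : ℕ) : ℝ≥0∞)) ∂P.runMeasure γ := by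
          refine lintegral_mono fun ρ => ?_
          simp only [hGe]
          rw [mul_left_comm]
          gcongr
          exact P.lintegral_kernel_potential_le _
      _ = 4 / 5 * ∫⁻ ρ, (∏ j ∈ Finset.range k, notPlain (ρ (n + 1 + j))) *
            (((ρ (n + k)).size + 2 : ℕ) : ℝ≥0∞) ∂P.runMeasure γ := by
          refine lintegral_const_mul _ (Measurable.mul ?_ (hm.comp (measurable_pi_apply _)))
          exact Finset.measurable_prod _ fun j _ => hnp.comp (measurable_pi_apply _)
      _ ≤ 4 / 5 * ((4 / 5) ^ k * (2 ^ n * ((γ.size + 2 : ℕ) : ℝ≥0∞))) := by gcongr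
      _ = _ := by ring

theorem runMeasure_forall_gt_not_plain (P : Program Proc Var Val Reg Label)
    (γ : Conf Proc Var Val Reg Label) (n : ℕ) :
    P.runMeasure γ {ρ | ∀ m > n, ¬ (ρ m).Plain} = 0 := by
  have hle : ∀ k : ℕ, P.runMeasure γ {ρ | ∀ m > n, ¬ (ρ m).Plain} ≤
      (4 / 5) ^ k * (2 ^ n * ((γ.size + 2 : ℕ) : ℝ≥0∞)) := fun k => by
    refine le_trans ?_ (P.lintegral_prod_notPlain_le γ n k)
    have hnp : Measurable fun γ : Conf Proc Var Val Reg Label => notPlain γ :=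
      measurable_from_top
    have hm : Measurable fun γ : Conf Proc Var Val Reg Label => ((γ.size + 2 : ℕ) : ℝ≥0∞) :=
      measurable_from_top
    have hmeas : Measurable fun ρ : ℕ → Conf Proc Var Val Reg Label =>
        (∏ j ∈ Finset.range k, notPlain (ρ (n + 1 + j))) *
          (((ρ (n + k)).size + 2 : ℕ) : ℝ≥0∞) := by
      refine Measurable.mul ?_ (hm.comp (measurable_pi_apply _))
      exact Finset.measurable_prod _ fun j _ => hnp.comp (measurable_pi_apply _)
    -- Markov's inequality at level `1`: on the event every indicator is `1`, so the integrand is at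
    -- least `1`.
    refine le_trans (measure_mono fun ρ hρ => ?_)
      ((one_mul _).symm.trans_le (mul_meas_ge_le_lintegral hmeas 1))
    have h1 : ∏ j ∈ Finset.range k, notPlain (ρ (n + 1 + j)) = 1 :=
      Finset.prod_eq_one fun j _ => by
        have := hρ (n + 1 + j) (by omega)
        rw [Conf.plain_iff_size] at this
        simp [notPlain, this]
    simp only [Set.mem_ofPred_eq, h1, one_mul]
    exact_mod_cast (by omega : 1 ≤ (ρ (n + k)).size + 2)
  have hlt : (4 / 5 : ℝ≥0∞) < 1 := by
    rw [ENNReal.div_lt_iff (by simp) (by simp)]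
    norm_num
  have hlim := ENNReal.Tendsto.mul_const (b := 2 ^ n * ((γ.size + 2 : ℕ) : ℝ≥0∞))
    (ENNReal.tendsto_pow_atTop_nhds_zero_of_lt_one hlt)
    (Or.inr (ENNReal.mul_ne_top (by simp) (ENNReal.natCast_ne_top _)))
  rw [zero_mul] at hlim
  exact le_antisymm (ge_of_tendsto' hlim hle) zero_le

theorem runMeasure_infinitely_often_plain (P : Program Proc Var Val Reg Label)
    (γ : Conf Proc Var Val Reg Label) :
    P.runMeasure γ {ρ | ∀ n, ∃ m ≥ n, (ρ m).Plain} = 1 := by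
  have hae : ∀ᵐ ρ ∂P.runMeasure γ, ∀ n, ∃ m ≥ n, (ρ m).Plain := by
    refine ae_all_iff.2 fun n => ?_
    rw [ae_iff]
    refine measure_mono_null ?_ (P.runMeasure_forall_gt_not_plain γ n)
    exact fun ρ hρ m hm hp => hρ ⟨m, le_of_lt hm, hp⟩
  rw [measure_eq_measure_of_null_sdiff (Set.subset_univ _) ?_, measure_univ]
  rw [← Set.compl_eq_univ_sdiff]
  exact hae

end Program

end PTSO

theorem mainTheorem5 {Proc Var Val : Type*} {Reg Label : Proc → Type*}
    [Fintype Proc] [Finite Var] [Finite Val] [∀ p, Finite (Reg p)] [∀ p, Finite (Label p)]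
    [DecidableEq Proc] [DecidableEq Var] [DecidableEq Val] [∀ p, DecidableEq (Reg p)]
    (P : PTSO.Program Proc Var Val Reg Label) :
    {γ : PTSO.Conf Proc Var Val Reg Label | γ.Plain}.Finite ∧
    P.IsAttractor {γ | γ.Plain} ∧
    ∀ γ : PTSO.Conf Proc Var Val Reg Label,
      P.runMeasure γ {ρ | ∀ n, ∃ m ≥ n, (ρ m).Plain} = 1 := by
  refine ⟨PTSO.Conf.finite_plain, fun γ => le_antisymm prob_le_one ?_,
    P.runMeasure_infinitely_often_plain⟩
  rw [← P.runMeasure_infinitely_often_plain γ]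
  exact measure_mono fun ρ hρ => (hρ 0).imp fun _ h => h.2
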